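/- All posets are finite. A poset is $(3+1)$-free if it has no induced subposet consisting of a chain $a<b<c$ together with an element incomparable to each of $a,b,c$. Let $P$ be a $(3+1)$-free poset, and for $a\in P$ let $D_a=\{x\in P: x<a\}$ and $U_a=\{x\in P: x>a\}$. A *top of a tangle* is a connected component with at least two vertices of the graph on $P$ in which $a,b$ are adjacent when neither of $D_a,D_b$ contains the other; a *bottom of a tangle* is a connected component with at least two vertices of the graph on $P$ in which $a,b$ are adjacent when neither of $U_a,U_b$ contains the other. A *tangle* of $P$ is a pair $(A,B)$, where $A$ is a top and $B$ is a bottom of a tangle, that is *matched*: there are $a,b\in A$ and $c,d\in B$ with $c<a$ and $d<b$ and with no other relations among $a,b,c,d$. Two tangles (of possibly different $(3+1)$-free posets) are isomorphic if there is an isomorphism between the induced subposets on their vertices that carries top to top and bottom to bottom. Unlabelled tangles are isomorphism classes of tangles; let $$T_{\mathrm{unl}}(x,y)=\sum_{i,j\ge 0} t_{ij}\,x^iy^j\in\mathbb{Q}[[x,y]],$$ where $t_{ij}$ is the number of isomorphism classes of tangles with $i$ bottom vertices and $j$ top vertices. A *bicoloured graph* is a finite simple graph with a specified ordered bipartition $(V_1,V_2)$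 of its vertex set (parts may be empty) such that every edge joins $V_1$ to $V_2$; isomorphisms of bicoloured graphs are graph isomorphisms that preserve each part. Let $$B_{\mathrm{unl}}(x,y)=\sum_{i,j\ge 0} b_{ij}\,x^iy^j\in\mathbb{Q}[[x,y]],$$ where $b_{ij}$ is the number of isomorphism classes of bicoloured graphs with $|V_1|=i$ and $|V_2|=j$. **Theorem.** The power series $B_{\mathrm{unl}}(x,y)$ is invertible in $\mathbb{Q}[[x,y]]$, and $$T_{\mathrm{unl}}(x,y)=1-x-y-B_{\mathrm{unl}}(x,y)^{-1}.$$ -/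

import Mathlib

namespace Tangles

/-! ### Three-plus-one-free posets and tangles -/

/-- `P` has no induced subposet formed by a chain `a < b < c` and an element `d` incomparable
to all of `a`, `b`, `c`. -/
def ThreePlusOneFree (P : Type) [PartialOrder P] : Prop :=
  ¬ ∃ a b c d : P, a < b ∧ b < c ∧
    IncompRel (· ≤ ·) a d ∧ IncompRel (· ≤ ·) b d ∧ IncompRel (· ≤ ·) c d

/-- The graph on `P` in which `a` and `b` are adjacent when their strict downsets are
incomparable under inclusion. -/
def topGraph (P : Type) [PartialOrder P] : SimpleGraph P where
  Adj a b := ¬ Set.Iio a ⊆ Set.Iio b ∧ ¬ Set.Iio b ⊆ Set.Iio a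
  symm := ⟨fun _ _ h => ⟨h.2, h.1⟩⟩
  loopless := ⟨fun _ h => h.1 subset_rfl⟩

/-- The graph on `P` in which `a` and `b` are adjacent when their strict upsets are
incomparable under inclusion. -/
def bottomGraph (P : Type) [PartialOrder P] : SimpleGraph P where
  Adj a b := ¬ Set.Ioi a ⊆ Set.Ioi b ∧ ¬ Set.Ioi b ⊆ Set.Ioi a
  symm := ⟨fun _ _ h => ⟨h.2, h.1⟩⟩
  loopless := ⟨fun _ h => h.1 subset_rfl⟩

/-- `A` is the top of a tangle: a connected component of `topGraph P` with at least two
elements. -/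
def IsTangleTop {P : Type} [PartialOrder P] (A : Set P) : Prop :=
  A.Nontrivial ∧ ∃ C : (topGraph P).ConnectedComponent, C.supp = A

/-- `B` is the bottom of a tangle: a connected component of `bottomGraph P` with at least two
elements. -/
def IsTangleBottom {P : Type} [PartialOrder P] (B : Set P) : Prop :=
  B.Nontrivial ∧ ∃ C : (bottomGraph P).ConnectedComponent, C.supp = B

/-- There is an induced `2 + 2` subposet (two chains `c < a` and `d < b` with no other
relations) whose top two vertices are in `A` and whose bottom two vertices are in `B`. -/
def Matched {P : Type} [PartialOrder P] (A B : Set P) : Prop :=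
  ∃ a ∈ A, ∃ b ∈ A, ∃ c ∈ B, ∃ d ∈ B, c < a ∧ d < b ∧
    IncompRel (· ≤ ·) a b ∧ IncompRel (· ≤ ·) c d ∧
    IncompRel (· ≤ ·) a d ∧ IncompRel (· ≤ ·) b c

/-- A tangle: a matched pair of a top of a tangle and a bottom of a tangle in some finite
`(3+1)`-free poset. -/
structure Tangle where
  /-- the ambient poset -/
  Carrier : Type
  [order : PartialOrder Carrier]
  [finite : Finite Carrier]
  free : ThreePlusOneFree Carrier
  top : Set Carrier
  bottom : Set Carrier
  isTop : IsTangleTop top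
  isBottom : IsTangleBottom bottom
  matched : Matched top bottom

attribute [instance] Tangle.order Tangle.finite

/-- Isomorphism of tangles: an isomorphism of the induced subposets on the vertices of the two
tangles that maps the top onto the top and the bottom onto the bottom. The rest of the ambient
posets plays no role. -/
def Tangle.Iso (S T : Tangle) : Prop :=
  ∃ e : ↥(S.top ∪ S.bottom) ≃o ↥(T.top ∪ T.bottom),
    (∀ v, (e v : T.Carrier) ∈ T.top ↔ (v : S.Carrier) ∈ S.top) ∧
    (∀ v, (e v : T.Carrier) ∈ T.bottom ↔ (v : S.Carrier) ∈ S.bottom)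

instance Tangle.setoid : Setoid Tangle where
  r := Tangle.Iso
  iseqv :=
    { refl := fun S => ⟨OrderIso.refl _, fun _ => Iff.rfl, fun _ => Iff.rfl⟩
      symm := by
        rintro S T ⟨e, h₁, h₂⟩
        refine ⟨e.symm, fun v => ?_, fun v => ?_⟩
        · rw [← h₁, e.apply_symm_apply]
        · rw [← h₂, e.apply_symm_apply]
      trans := by
        rintro S T U ⟨e, h₁, h₂⟩ ⟨f, k₁, k₂⟩
        exact ⟨e.trans f, fun v => (k₁ (e v)).trans (h₁ v), fun v => (k₂ (e v)).trans (h₂ v)⟩ }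

/-- Unlabelled tangles: isomorphism classes of tangles. -/
abbrev UnlabelledTangle : Type 1 := Quotient Tangle.setoid

/-- The isomorphism classes of tangles with `i` bottom vertices and `j` top vertices. -/
def unlabelledTangles (i j : ℕ) : Set UnlabelledTangle :=
  Quotient.mk Tangle.setoid '' {T : Tangle | T.bottom.ncard = i ∧ T.top.ncard = j}

/-! ### Bicoloured graphs -/

/-- A finite simple graph with a fixed proper colouring in the two colours `0`, `1`
(a colour class may be empty). -/
structure BicolouredGraph where
  Vertex : Type
  [finite : Finite Vertex]
  graph : SimpleGraph Vertex
  colour : graph.Coloring (Fin 2)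

attribute [instance] BicolouredGraph.finite

/-- Isomorphism of bicoloured graphs: a graph isomorphism that preserves each colour. -/
def BicolouredGraph.Iso (G H : BicolouredGraph) : Prop :=
  ∃ e : G.graph ≃g H.graph, ∀ v, H.colour (e v) = G.colour v

instance BicolouredGraph.setoid : Setoid BicolouredGraph where
  r := BicolouredGraph.Iso
  iseqv :=
    { refl := fun G => ⟨SimpleGraph.Iso.refl, fun _ => rfl⟩
      symm := by
        rintro G H ⟨e, h⟩
        refine ⟨e.symm, fun v => ?_⟩
        rw [← h, RelIso.apply_symm_apply]
      trans := by
        rintro G H K ⟨e, h⟩ ⟨f, k⟩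
        exact ⟨e.trans f, fun v => (k (e v)).trans (h v)⟩ }

/-- Unlabelled bicoloured graphs: isomorphism classes of bicoloured graphs. -/
abbrev UnlabelledBicolouredGraph : Type 1 := Quotient BicolouredGraph.setoid

/-- The isomorphism classes of bicoloured graphs with `i` vertices of colour `0` and `j`
vertices of colour `1`. -/
def unlabelledBicolouredGraphs (i j : ℕ) : Set UnlabelledBicolouredGraph :=
  Quotient.mk BicolouredGraph.setoid ''
    {G : BicolouredGraph | {v | G.colour v = 0}.ncard = i ∧ {v | G.colour v = 1}.ncard = j}

/-! ### Both families are finite in each size, so that `Set.ncard` counts them -/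

theorem finite_classes {α : Type 1} {β : Type} [Finite β] (s : Setoid α) (S : Set α)
    (R : α → β → Prop) (h₁ : ∀ x ∈ S, ∃ b, R x b)
    (h₂ : ∀ x y b, R x b → R y b → s.r x y) :
    (Quotient.mk s '' S).Finite := by
  rcases isEmpty_or_nonempty β with hβ | hβ
  · have hS : S = ∅ := Set.eq_empty_of_forall_notMem fun x hx => hβ.elim (h₁ x hx).choose
    simp [hS]
  rcases isEmpty_or_nonempty α with hα | hα
  · simp [Set.eq_empty_of_isEmpty S]
  choose! c hc using h₁
  choose! g hg using fun (q : Quotient s) (hq : q ∈ Quotient.mk s '' S) => hq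
  refine Set.Finite.of_finite_image (f := fun q => c (g q)) (Set.toFinite _) ?_
  intro p hp q hq hpq
  rw [← (hg p hp).2, ← (hg q hq).2]
  refine Quotient.sound (h₂ _ _ _ (hc _ (hg p hp).1) ?_)
  have : c (g p) = c (g q) := hpq
  rw [this]
  exact hc _ (hg q hq).1

theorem finite_unlabelledBicolouredGraphs (i j : ℕ) :
    (unlabelledBicolouredGraphs i j).Finite := by
  refine finite_classes (β := (Fin (i + j) → Fin (i + j) → Prop) × (Fin (i + j) → Fin 2)) _ _
    (fun G b => ∃ e : G.Vertex ≃ Fin (i + j),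
      (∀ v w, G.graph.Adj v w ↔ b.1 (e v) (e w)) ∧ ∀ v, G.colour v = b.2 (e v)) ?_ ?_
  · rintro G ⟨hi, hj⟩
    have hu : {v | G.colour v = 0} ∪ {v | G.colour v = 1} = Set.univ := by
      ext v
      simp only [Set.mem_union, Set.mem_ofPred_eq, Set.mem_univ, iff_true]
      generalize G.colour v = x
      fin_cases x <;> simp
    have hd : Disjoint {v | G.colour v = 0} {v | G.colour v = 1} := by
      rw [Set.disjoint_left]
      intro v hv hw
      simp only [Set.mem_ofPred_eq] at hv hw
      rw [hv] at hw
      exact absurd hw (by decide)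
    have hc : Nat.card G.Vertex = i + j := by
      rw [← Set.ncard_univ, ← hu, Set.ncard_union_eq hd, hi, hj]
    let e : G.Vertex ≃ Fin (i + j) := Finite.equivFinOfCardEq hc
    exact ⟨(fun v w => G.graph.Adj (e.symm v) (e.symm w), fun v => G.colour (e.symm v)), e,
      by simp, by simp⟩
  · rintro G H b ⟨e, he, hk⟩ ⟨f, hf, hl⟩
    refine ⟨⟨e.trans f.symm, ?_⟩, ?_⟩
    · intro v w
      simp [he, hf]
    · intro v
      change H.colour (f.symm (e v)) = _
      simp [hk, hl]

theorem finite_unlabelledTangles (i j : ℕ) : (unlabelledTangles i j).Finite := by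
  refine finite_classes (β := (m : Fin (i + j + 1)) × (Fin m → Fin m → Prop) ×
      (Fin m → Prop) × (Fin m → Prop)) _ _
    (fun T b => ∃ e : ↥(T.top ∪ T.bottom) ≃ Fin b.1,
      (∀ v w : ↥(T.top ∪ T.bottom), v ≤ w ↔ b.2.1 (e v) (e w)) ∧
      (∀ v : ↥(T.top ∪ T.bottom), (v : T.Carrier) ∈ T.top ↔ b.2.2.1 (e v)) ∧
      ∀ v : ↥(T.top ∪ T.bottom), (v : T.Carrier) ∈ T.bottom ↔ b.2.2.2 (e v)) ?_ ?_
  · rintro T ⟨hi, hj⟩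
    have hc : Nat.card ↥(T.top ∪ T.bottom) < i + j + 1 := by
      rw [Nat.card_coe_set_eq]
      have := Set.ncard_union_le T.top T.bottom
      omega
    let e := Finite.equivFin ↥(T.top ∪ T.bottom)
    refine ⟨⟨⟨_, hc⟩, fun v w => e.symm v ≤ e.symm w, fun v => (e.symm v : T.Carrier) ∈ T.top,
      fun v => (e.symm v : T.Carrier) ∈ T.bottom⟩, e, ?_, ?_, ?_⟩
    · intro v w
      change _ ↔ e.symm (e v) ≤ e.symm (e w)
      rw [e.symm_apply_apply, e.symm_apply_apply]
    · intro v
      change _ ↔ ((e.symm (e v) : ↥(T.top ∪ T.bottom)) : T.Carrier) ∈ T.top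
      rw [e.symm_apply_apply]
    · intro v
      change _ ↔ ((e.symm (e v) : ↥(T.top ∪ T.bottom)) : T.Carrier) ∈ T.bottom
      rw [e.symm_apply_apply]
  · rintro S T b ⟨e, he, h₁, h₂⟩ ⟨f, hf, k₁, k₂⟩
    refine ⟨⟨e.trans f.symm, ?_⟩, ?_, ?_⟩
    · intro v w
      rw [he, hf]
      simp
    · intro v
      rw [k₁, h₁]
      simp
    · intro v
      rw [k₂, h₂]
      simp

/-! ### Generating functions

The variable `x = X 0` marks bottom vertices (colour `0`) and `y = X 1` marks top vertices
(colour `1`). -/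

/-- The ordinary generating function of unlabelled tangles. -/
noncomputable def tangleGF : MvPowerSeries (Fin 2) ℚ :=
  fun n => ((unlabelledTangles (n 0) (n 1)).ncard : ℚ)

/-- The ordinary generating function of unlabelled bicoloured graphs. -/
noncomputable def bicolouredGF : MvPowerSeries (Fin 2) ℚ :=
  fun n => ((unlabelledBicolouredGraphs (n 0) (n 1)).ncard : ℚ)

end Tangles

/-! The identity says that `B = 1 / (1 - (x + y + T))`, the generating function of sequences of
irreducibles. Compose bicoloured graphs by taking the disjoint union and joining every colour-0
vertex of the first factor to every colour-1 vertex of the second. Two facts are needed.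

Factorisation. A first factor is an initial set of vertices. A minimal nonempty one is irreducible,
so every nonempty graph is an irreducible followed by a remainder (`exists_iso_comp`). As a set the
irreducible first factor need not be unique (in an edgeless graph of one colour every vertex is
one), but any two are exchanged by an automorphism (`exists_automorphism`), so both factors are
unique up to isomorphism (`iso_of_comp_iso`). Counting gives `B = 1 + I * B`, with `I` counting
irreducibles.

Identification. `I = x + y + T`: the irreducibles on one vertex give `x + y`, and the others are
exactly the comparability graphs of tangles, with bottoms coloured 0 and tops 1. A tangle is
irreducible because an initial set is propagated along the components that form its top and its
bottom, and the matching `2 + 2` excludes having just one of the two (`Tangle.isIrreducible`).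
Conversely, an irreducible graph on at least two vertices is a poset without 3-element chains; if
its colour-1 class broke into several components of `topGraph`, comparing downsets across components
would produce a proper nonempty initial set (`reachable_of_forall_isOrderInitial`). Order duality
handles the bottoms. -/

namespace Tangles

/-! ### Composition of bicoloured graphs -/

namespace BicolouredGraph

/-- The set of vertices of a given colour. -/
def colourClass (G : BicolouredGraph) (k : Fin 2) : Set G.Vertex := {v | G.colour v = k}

theorem not_adj_of_colour_eq (G : BicolouredGraph) {v w : G.Vertex}
    (h : G.colour v = G.colour w) : ¬ G.graph.Adj v w :=
  fun hv => G.colour.valid hv h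

/-- The composition of two bicoloured graphs: the disjoint union, together with all edges from
a vertex of colour `0` of the first graph to a vertex of colour `1` of the second. -/
def comp (G H : BicolouredGraph) : BicolouredGraph where
  Vertex := G.Vertex ⊕ H.Vertex
  graph :=
    { Adj := fun
        | .inl v, .inl w => G.graph.Adj v w
        | .inr v, .inr w => H.graph.Adj v w
        | .inl v, .inr w => G.colour v = 0 ∧ H.colour w = 1
        | .inr w, .inl v => G.colour v = 0 ∧ H.colour w = 1
      symm := ⟨by
        rintro (v | v) (w | w) h
        · exact G.graph.adj_symm h
        · exact h
        · exact h
        · exact H.graph.adj_symm h⟩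
      loopless := ⟨by
        rintro (v | v) h
        · exact G.graph.irrefl h
        · exact H.graph.irrefl h⟩ }
  colour := SimpleGraph.Coloring.mk (Sum.elim G.colour H.colour) (by
    rintro (v | v) (w | w) h
    · exact G.colour.valid h
    · change G.colour v ≠ H.colour w
      rw [h.1, h.2]; decide
    · change H.colour v ≠ G.colour w
      rw [h.1, h.2]; decide
    · exact H.colour.valid h)

/-- The induced bicoloured subgraph on a set of vertices. -/
def restrict (G : BicolouredGraph) (S : Set G.Vertex) : BicolouredGraph where
  Vertex := S
  graph := G.graph.induce S
  colour := SimpleGraph.Coloring.mk (fun v => G.colour v) (fun h => G.colour.valid h)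

/-- A set of vertices is initial if its colour-`0` vertices are joined to all colour-`1` vertices
outside, and there are no other edges leaving it. -/
def IsInitial (G : BicolouredGraph) (S : Set G.Vertex) : Prop :=
  ∀ v ∈ S, ∀ w ∉ S, G.graph.Adj v w ↔ G.colour v = 0 ∧ G.colour w = 1

/-- A bicoloured graph is irreducible if it is not empty and has no proper nonempty initial set of
vertices, that is, if it is not a composition of two nonempty bicoloured graphs. -/
def IsIrreducible (G : BicolouredGraph) : Prop :=
  Nonempty G.Vertex ∧ ∀ S, G.IsInitial S → S = ∅ ∨ S = Set.univ

theorem IsInitial.inter {G : BicolouredGraph} {S T : Set G.Vertex} (hS : G.IsInitial S)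
    (hT : G.IsInitial T) : G.IsInitial (S ∩ T) := by
  intro v hv w hw
  by_cases hwS : w ∈ S
  · exact hT v hv.2 w fun hwT => hw ⟨hwS, hwT⟩
  · exact hS v hv.1 w hwS

theorem IsInitial.image_restrict {G : BicolouredGraph} {S : Set G.Vertex} (hS : G.IsInitial S)
    {T : Set S} (hT : (G.restrict S).IsInitial T) : G.IsInitial (Subtype.val '' T) := by
  rintro _ ⟨v, hv, rfl⟩ w hw
  by_cases hwS : w ∈ S
  · exact hT v hv ⟨w, hwS⟩ fun h => hw ⟨_, h, rfl⟩
  · exact hS v v.2 w hwS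

theorem IsInitial.preimage_iso {G H : BicolouredGraph} (e : G.graph ≃g H.graph)
    (he : ∀ v, H.colour (e v) = G.colour v) {S : Set H.Vertex} (hS : H.IsInitial S) :
    G.IsInitial (e ⁻¹' S) := by
  intro v hv w hw
  rw [← he, ← he, ← hS _ hv _ hw]
  exact e.map_rel_iff.symm

theorem IsIrreducible.of_iso {G H : BicolouredGraph} (h : G.Iso H) (hG : G.IsIrreducible) :
    H.IsIrreducible := by
  obtain ⟨e, he⟩ := h
  refine ⟨hG.1.map e, fun S hS => ?_⟩
  rcases hG.2 _ (hS.preimage_iso e he) with h | h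
  · left
    rwa [← e.surjective.preimage_injective.eq_iff, Set.preimage_empty]
  · right
    rwa [← e.surjective.preimage_injective.eq_iff, Set.preimage_univ]

theorem restrict_iso {G H : BicolouredGraph} (e : G.graph ≃g H.graph)
    (he : ∀ v, H.colour (e v) = G.colour v) {S : Set G.Vertex} {T : Set H.Vertex}
    (h : ∀ v, v ∈ S ↔ e v ∈ T) : (G.restrict S).Iso (H.restrict T) :=
  ⟨⟨e.toEquiv.subtypeEquiv h, e.map_rel_iff⟩, fun (v : S) => he v⟩

theorem restrict_range_iso {G H : BicolouredGraph} (f : G.graph ↪g H.graph)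
    (hf : ∀ v, H.colour (f v) = G.colour v) : G.Iso (H.restrict (Set.range f)) :=
  ⟨⟨Equiv.ofInjective f f.injective, f.map_rel_iff⟩, hf⟩

/-- The inclusion of the first factor in a composition. -/
def compInl (G H : BicolouredGraph) : G.graph ↪g (G.comp H).graph :=
  ⟨Function.Embedding.inl, Iff.rfl⟩

/-- The inclusion of the second factor in a composition. -/
def compInr (G H : BicolouredGraph) : H.graph ↪g (G.comp H).graph :=
  ⟨Function.Embedding.inr, Iff.rfl⟩

theorem isInitial_range_compInl (G H : BicolouredGraph) :
    (G.comp H).IsInitial (Set.range (compInl G H)) := by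
  rintro _ ⟨v, rfl⟩ (w | w) hw
  · exact absurd ⟨w, rfl⟩ hw
  · exact Iff.rfl

theorem range_compInr (G H : BicolouredGraph) :
    Set.range (compInr G H) = (Set.range (compInl G H))ᶜ :=
  Set.isCompl_range_inl_range_inr.compl_eq.symm

theorem iso_comp_restrict {G : BicolouredGraph} {S : Set G.Vertex} (hS : G.IsInitial S) :
    ((G.restrict S).comp (G.restrict Sᶜ)).Iso G := by
  classical
  refine ⟨⟨Equiv.Set.sumCompl S, ?_⟩, ?_⟩
  · rintro ((v : S) | (v : ↥Sᶜ)) ((w : S) | (w : ↥Sᶜ))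
    · exact Iff.rfl
    · exact hS v v.2 w w.2
    · exact (G.graph.adj_comm _ _).trans (hS w w.2 v v.2)
    · exact Iff.rfl
  · rintro (v | v) <;> rfl

theorem comp_congr {G G' H H' : BicolouredGraph} (hG : G.Iso G') (hH : H.Iso H') :
    (G.comp H).Iso (G'.comp H') := by
  obtain ⟨e, he⟩ := hG
  obtain ⟨f, hf⟩ := hH
  refine ⟨⟨Equiv.sumCongr e.toEquiv f.toEquiv, ?_⟩, ?_⟩
  · rintro (v | v) (w | w)
    · exact e.map_rel_iff
    · change G'.colour (e v) = 0 ∧ H'.colour (f w) = 1 ↔ G.colour v = 0 ∧ H.colour w = 1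
      rw [he, hf]
    · change G'.colour (e w) = 0 ∧ H'.colour (f v) = 1 ↔ G.colour w = 0 ∧ H.colour v = 1
      rw [he, hf]
    · exact f.map_rel_iff
  · rintro (v | v)
    · exact he v
    · exact hf v

theorem isInitial_singleton {G : BicolouredGraph} {S : Set G.Vertex} (hS : G.IsInitial S)
    {v : G.Vertex} (hv : v ∈ S) (hc : ∀ w ∈ S, G.colour w = G.colour v) :
    G.IsInitial {v} := by
  rintro _ rfl w hw
  by_cases hwS : w ∈ S
  · have h := hc w hwS
    simp only [G.not_adj_of_colour_eq h.symm, h, false_iff]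
    intro h'
    rw [h'.1] at h'
    exact absurd h'.2 (by decide)
  · exact hS _ hv w hwS

/-! ### Uniqueness and existence of the irreducible first factor. -/

theorem eq_of_isIrreducible_restrict {G : BicolouredGraph} {S T : Set G.Vertex}
    (hS : (G.restrict S).IsIrreducible) (hT : G.IsInitial T) (hTn : T.Nonempty) (h : T ⊆ S) :
    T = S := by
  have hT' : (G.restrict S).IsInitial (Subtype.val ⁻¹' T) := fun (v : S) hv (w : S) hw => hT v hv w hw
  rcases hS.2 _ hT' with h' | h'
  · obtain ⟨v, hv⟩ := hTn
    exact absurd hv (Set.eq_empty_iff_forall_notMem.1 h' ⟨v, h hv⟩)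
  · exact h.antisymm fun v hv => Set.eq_univ_iff_forall.1 h' ⟨v, hv⟩

/-- Two irreducible initial parts of a bicoloured graph are conjugate under automorphisms. -/
theorem exists_automorphism {G : BicolouredGraph} {S T : Set G.Vertex}
    (hS : G.IsInitial S) (hT : G.IsInitial T) (hS' : (G.restrict S).IsIrreducible)
    (hT' : (G.restrict T).IsIrreducible) :
    ∃ e : G.graph ≃g G.graph, (∀ v, G.colour (e v) = G.colour v) ∧ ∀ v, v ∈ S ↔ e v ∈ T := by
  classical
  rcases (S ∩ T).eq_empty_or_nonempty with h | h
  · have hd := Set.disjoint_left.1 (Set.disjoint_iff_inter_eq_empty.2 h)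
    -- If `S` and `T` are disjoint, each prescribes the edges to the other: `v` and `w` are adjacent
    -- iff their colours are `(0, 1)`, and also iff they are `(1, 0)`. So neither holds, and `S ∪ T`
    -- has one colour. Its singletons are then initial, so `S` and `T` are single vertices with the
    -- same neighbours, and the transposition is the automorphism.
    have hc : ∀ v ∈ S, ∀ w ∈ T, G.colour v = G.colour w := by
      intro v hv w hw
      have h₁ := hS v hv w fun h => hd h hw
      have h₂ := hT w hw v fun h => hd hv h
      rw [G.graph.adj_comm, h₁] at h₂
      generalize G.colour v = i at h₂
      generalize G.colour w = j at h₂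
      revert i j
      decide
    obtain ⟨v, hv⟩ := hS'.1
    obtain ⟨w, hw⟩ := hT'.1
    have hiv := isInitial_singleton hS hv
      fun x hx => (hc x hx w hw).trans (hc v hv w hw).symm
    have hiw := isInitial_singleton hT hw
      fun x hx => (hc v hv x hx).symm.trans (hc v hv w hw)
    obtain rfl := eq_of_isIrreducible_restrict hS' hiv ⟨v, rfl⟩ (by simpa using hv)
    obtain rfl := eq_of_isIrreducible_restrict hT' hiw ⟨w, rfl⟩ (by simpa using hw)
    have hvw := hc v rfl w rfl
    have hn : ¬ G.graph.Adj v w := G.not_adj_of_colour_eq hvw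
    have hn' : ¬ G.graph.Adj w v := G.not_adj_of_colour_eq hvw.symm
    have key : ∀ x, x ≠ v → x ≠ w → (G.graph.Adj v x ↔ G.graph.Adj w x) := by
      intro x hxv hxw
      rw [hS v rfl x hxv, hT w rfl x hxw, hvw]
    have key' : ∀ x, x ≠ v → x ≠ w → (G.graph.Adj x v ↔ G.graph.Adj x w) := by
      intro x hxv hxw
      rw [G.graph.adj_comm, key x hxv hxw, G.graph.adj_comm]
    refine ⟨⟨Equiv.swap v w, ?_⟩, ?_, ?_⟩
    · intro x y
      simp only [Equiv.swap_apply_def]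
      split_ifs with h₁ h₂ h₂ h₂ h₂ h₂ h₂ h₂ <;> subst_vars <;>
        simp_all
    · intro x
      change G.colour (Equiv.swap v w x) = _
      simp only [Equiv.swap_apply_def]
      split_ifs <;> simp_all
    · intro x
      change x = v ↔ Equiv.swap v w x = w
      rw [Equiv.swap_apply_eq_iff, Equiv.swap_apply_right]
  · have h₁ := eq_of_isIrreducible_restrict hS' (hS.inter hT) h Set.inter_subset_left
    have h₂ := eq_of_isIrreducible_restrict hT' (hS.inter hT) h Set.inter_subset_right
    obtain rfl := h₁.symm.trans h₂
    exact ⟨SimpleGraph.Iso.refl, fun _ => rfl, fun _ => Iff.rfl⟩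

/-- Pulled back along the isomorphism, the second first factor becomes another irreducible initial
set of `G.comp H`. An automorphism carries one to the other, hence also their complements, which are
the second factors. -/
theorem iso_of_comp_iso {G G' H H' : BicolouredGraph} (hG : G.IsIrreducible)
    (hG' : G'.IsIrreducible) (h : (G.comp H).Iso (G'.comp H')) : G.Iso G' ∧ H.Iso H' := by
  obtain ⟨e, he⟩ := h
  have hl := restrict_range_iso (compInl G H) fun _ => rfl
  have hr := restrict_range_iso (compInr G H) fun _ => rfl
  have hl' := restrict_range_iso (compInl G' H') fun _ => rfl
  have hr' := restrict_range_iso (compInr G' H') fun _ => rfl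
  have hT := restrict_iso e he (S := e ⁻¹' Set.range (compInl G' H')) fun _ => Iff.rfl
  obtain ⟨φ, hφ, hST⟩ := exists_automorphism (isInitial_range_compInl G H)
    ((isInitial_range_compInl G' H').preimage_iso e he) (hG.of_iso hl)
    (hG'.of_iso (setoid.trans hl' (setoid.symm hT)))
  have hc : ∀ v, (G'.comp H').colour ((φ.trans e) v) = (G.comp H).colour v :=
    fun v => (he _).trans (hφ v)
  constructor
  · exact setoid.trans hl (setoid.trans (restrict_iso (φ.trans e) hc hST) (setoid.symm hl'))
  · refine setoid.trans hr (setoid.trans (restrict_iso (φ.trans e) hc ?_) (setoid.symm hr'))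
    intro v
    rw [range_compInr, range_compInr]
    exact not_congr (hST v)

theorem exists_iso_comp (G : BicolouredGraph) (hG : Nonempty G.Vertex) :
    ∃ H K : BicolouredGraph, H.IsIrreducible ∧ (H.comp K).Iso G := by
  -- An initial subset of an initial set is initial in the whole graph, so minimality of `S` makes
  -- `G.restrict S` irreducible.
  obtain ⟨S, ⟨hS, hSn⟩, hmin⟩ := exists_minimal_of_wellFoundedLT
    (fun S : Set G.Vertex => G.IsInitial S ∧ S.Nonempty)
    ⟨Set.univ, fun v _ w hw => absurd (Set.mem_univ w) hw, Set.univ_nonempty⟩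
  refine ⟨G.restrict S, G.restrict Sᶜ, ⟨hSn.to_subtype, fun T hT => ?_⟩, iso_comp_restrict hS⟩
  rcases T.eq_empty_or_nonempty with h | h
  · exact .inl h
  · right
    have h' := hmin ⟨hS.image_restrict hT, h.image _⟩ (Subtype.coe_image_subset S T)
    refine Set.eq_univ_of_forall fun v => ?_
    obtain ⟨w, hw, hwv⟩ := h' v.2
    rwa [← Subtype.ext hwv]

theorem ncard_colourClass_of_iso {G H : BicolouredGraph} (h : G.Iso H) (k : Fin 2) :
    (G.colourClass k).ncard = (H.colourClass k).ncard := by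
  obtain ⟨e, he⟩ := h
  refine Set.ncard_congr (fun v _ => e v) (fun v hv => (he v).trans hv)
    (fun v w _ _ h => e.injective h) fun w hw => ⟨e.symm w, ?_, e.apply_symm_apply w⟩
  change G.colour _ = k
  rw [← he, e.apply_symm_apply]
  exact hw

theorem ncard_colourClass_comp (G H : BicolouredGraph) (k : Fin 2) :
    ((G.comp H).colourClass k).ncard = (G.colourClass k).ncard + (H.colourClass k).ncard := by
  have h : {v | Sum.elim G.colour H.colour v = k} =
      Sum.inl '' G.colourClass k ∪ Sum.inr '' H.colourClass k := by
    ext (v | v) <;> simp [colourClass]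
  change {v | Sum.elim G.colour H.colour v = k}.ncard = _
  rw [h, Set.ncard_union_eq, Set.ncard_image_of_injective _ Sum.inl_injective,
    Set.ncard_image_of_injective _ Sum.inr_injective]
  rw [Set.disjoint_left]
  rintro _ ⟨v, -, rfl⟩ ⟨w, -, h⟩
  cases h

end BicolouredGraph

/-! ### Tangles in a `(3+1)`-free poset -/

theorem ThreePlusOneFree.le_or_le {P : Type} [PartialOrder P] (hP : ThreePlusOneFree P)
    {a b c : P} (hab : a < b) (hbc : b < c) (d : P) : a ≤ d ∨ d ≤ c := by
  by_contra! h
  exact hP ⟨a, b, c, d, hab, hbc, ⟨h.1, fun h' => h.2 (h'.trans (hab.trans hbc).le)⟩,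
    ⟨fun h' => h.1 (hab.le.trans h'), fun h' => h.2 (h'.trans hbc.le)⟩,
    ⟨fun h' => h.1 ((hab.trans hbc).le.trans h'), h.2⟩⟩

theorem ThreePlusOneFree.dual {P : Type} [PartialOrder P] (hP : ThreePlusOneFree P) :
    ThreePlusOneFree Pᵒᵈ := by
  rintro ⟨a, b, c, d, hab, hbc, ha, hb, hc⟩
  exact hP ⟨c, b, a, d, hbc, hab, hc.symm, hb.symm, ha.symm⟩

theorem topGraph_adj_exists {P : Type} [PartialOrder P] {a b : P} (h : (topGraph P).Adj a b) :
    ∃ c d, c < a ∧ ¬ c < b ∧ d < b ∧ ¬ d < a := by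
  obtain ⟨c, hc, hc'⟩ := Set.not_subset.1 h.1
  obtain ⟨d, hd, hd'⟩ := Set.not_subset.1 h.2
  exact ⟨c, d, hc, hc', hd, hd'⟩

theorem bottomGraph_adj_of_lt {P : Type} [PartialOrder P] {a b c d : P} (hca : c < a)
    (hcb : ¬ c < b) (hdb : d < b) (hda : ¬ d < a) : (bottomGraph P).Adj c d :=
  ⟨fun h => hda (h hca), fun h => hcb (h hdb)⟩

/-- With `c` below `a` but not `b`, every `e > a` completes a chain `c < a < e`. Freeness relates
`b` to this chain, and every possibility but `b < e` contradicts the choice of witnesses. Thus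
upsets are constant on each component of the top graph. -/
theorem ThreePlusOneFree.Ioi_subset_of_adj {P : Type} [PartialOrder P] (hP : ThreePlusOneFree P)
    {a b : P} (h : (topGraph P).Adj a b) : Set.Ioi a ⊆ Set.Ioi b := by
  obtain ⟨c, d, hca, hcb, hdb, hda⟩ := topGraph_adj_exists h
  intro e (he : a < e)
  change b < e
  rcases hP.le_or_le hca he b with h' | h'
  · rcases h'.lt_or_eq with h' | rfl
    · exact absurd h' hcb
    · exact absurd (hdb.trans hca) hda
  · rcases h'.lt_or_eq with h' | rfl
    · exact h'
    · exact absurd (hca.trans he) hcb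

theorem ThreePlusOneFree.Ioi_eq_of_reachable {P : Type} [PartialOrder P]
    (hP : ThreePlusOneFree P) {a b : P} (h : (topGraph P).Reachable a b) :
    Set.Ioi a = Set.Ioi b := by
  rw [SimpleGraph.reachable_iff_reflTransGen] at h
  induction h with
  | refl => rfl
  | tail _ h ih =>
    exact ih.trans ((hP.Ioi_subset_of_adj h).antisymm (hP.Ioi_subset_of_adj h.symm))

/-- If `x`, `y`, `z` are consecutive in the top graph, then the vertices that witness the two
adjacencies are in the same component of the bottom graph. -/
theorem reachable_of_topGraph_adj {P : Type} [PartialOrder P] {x y z e f e' f' : P}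
    (hex : e < x) (hey : ¬ e < y) (hfy : f < y) (hfx : ¬ f < x)
    (hey' : e' < y) (hez' : ¬ e' < z) (hfz' : f' < z) (hfy' : ¬ f' < y) :
    (bottomGraph P).Reachable f e' := by
  -- In this case `e'` is not below `x`, so `f`, `e`, `e'` is a path; in the opposite inclusion `f`
  -- is not below `z`, and `f`, `f'`, `e'` is a path. With neither inclusion, `f` and `e'` are
  -- adjacent.
  by_cases h : Set.Ioi e' ⊆ Set.Ioi f
  · have h₁ := bottomGraph_adj_of_lt hex hey hfy hfx
    have h₂ : (bottomGraph P).Adj e e' := bottomGraph_adj_of_lt hex hey hey' fun h' => hfx (h h')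
    exact h₁.symm.reachable.trans h₂.reachable
  by_cases h' : Set.Ioi f ⊆ Set.Ioi e'
  · have h₁ := bottomGraph_adj_of_lt hey' hez' hfz' hfy'
    have h₂ : (bottomGraph P).Adj f f' :=
      bottomGraph_adj_of_lt hfy (fun h₂ => hez' (h' h₂)) hfz' hfy'
    exact h₂.reachable.trans h₁.symm.reachable
  exact SimpleGraph.Adj.reachable ⟨h', h⟩

/-- The condition on `S` that every element of `B ∩ S` is below every element of `A \ S`, and no
element of `B \ S` is below an element of `A ∩ S`. -/
def IsOrderInitial {P : Type} [PartialOrder P] (A B S : Set P) : Prop :=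
  ∀ b ∈ B, ∀ a ∈ A, (b ∈ S → a ∉ S → b < a) ∧ (b ∉ S → a ∈ S → ¬ b < a)

theorem IsOrderInitial.dual {P : Type} [PartialOrder P] {A B S : Set P}
    (h : IsOrderInitial A B S) : IsOrderInitial (P := Pᵒᵈ) B A (Sᶜ : Set P) :=
  fun a ha b hb => ⟨fun h₁ h₂ => (h b hb a ha).1 (not_not.1 h₂) h₁,
    fun h₁ h₂ => (h b hb a ha).2 h₂ (not_not.1 h₁)⟩

namespace Tangle

/-- The tangle obtained by reversing the order. -/
def dual (T : Tangle) : Tangle where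
  Carrier := T.Carrierᵒᵈ
  finite := T.finite
  free := T.free.dual
  top := T.bottom
  bottom := T.top
  isTop := T.isBottom
  isBottom := T.isTop
  matched := by
    obtain ⟨a, ha, b, hb, c, hc, d, hd, hca, hdb, hab, hcd, had, hbc⟩ := T.matched
    exact ⟨c, hc, d, hd, a, ha, b, hb, hca, hdb, hcd.symm, hab.symm, hbc, had⟩

/-! ### Order structure of a single tangle, and its rigidity under initial sets. -/

variable (T : Tangle)

theorem reachable_top {a b : T.Carrier} (ha : a ∈ T.top) (hb : b ∈ T.top) :
    (topGraph T.Carrier).Reachable a b := by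
  obtain ⟨-, C, hC⟩ := T.isTop
  rw [← hC] at ha hb
  exact SimpleGraph.ConnectedComponent.exact (ha.trans hb.symm)

theorem mem_top_of_reachable {a b : T.Carrier} (ha : a ∈ T.top)
    (h : (topGraph T.Carrier).Reachable a b) : b ∈ T.top := by
  obtain ⟨-, C, hC⟩ := T.isTop
  rw [← hC] at ha ⊢
  exact (SimpleGraph.ConnectedComponent.sound h.symm).trans ha

theorem mem_bottom_of_reachable {a b : T.Carrier} (ha : a ∈ T.bottom)
    (h : (bottomGraph T.Carrier).Reachable a b) : b ∈ T.bottom :=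
  T.dual.mem_top_of_reachable ha h

theorem not_lt_of_mem_top {a b : T.Carrier} (ha : a ∈ T.top) (hb : b ∈ T.top) : ¬ a < b := by
  intro h
  change b ∈ Set.Ioi a at h
  rw [T.free.Ioi_eq_of_reachable (T.reachable_top ha hb)] at h
  exact lt_irrefl b h

theorem not_lt_of_mem_bottom {a b : T.Carrier} (ha : a ∈ T.bottom) (hb : b ∈ T.bottom) :
    ¬ a < b :=
  T.dual.not_lt_of_mem_top hb ha

theorem Ioi_eq_of_mem_top {a b : T.Carrier} (ha : a ∈ T.top) (hb : b ∈ T.top) :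
    Set.Ioi a = Set.Ioi b :=
  T.free.Ioi_eq_of_reachable (T.reachable_top ha hb)

theorem Iio_eq_of_mem_bottom {a b : T.Carrier} (ha : a ∈ T.bottom) (hb : b ∈ T.bottom) :
    Set.Iio a = Set.Iio b :=
  T.dual.Ioi_eq_of_mem_top ha hb

theorem exists_adj_of_mem_top {a : T.Carrier} (ha : a ∈ T.top) :
    ∃ b ∈ T.top, (topGraph T.Carrier).Adj a b := by
  obtain ⟨b, hb, hba⟩ := T.isTop.1.exists_ne a
  have h := T.reachable_top ha hb
  rw [SimpleGraph.reachable_iff_reflTransGen] at h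
  rcases h.cases_head with rfl | ⟨c, hc, -⟩
  · exact absurd rfl hba
  · exact ⟨c, T.mem_top_of_reachable ha hc.reachable, hc⟩

/-- A common vertex `z` would share its downset with the bottom vertex `c < a`. An `e` below `z` but
not below a neighbour `x` then gives a chain `e < c < a`, whose forced relation to `x` is
impossible. -/
theorem disjoint_top_bottom : Disjoint T.top T.bottom := by
  rw [Set.disjoint_left]
  intro z hz hz'
  obtain ⟨a, ha, -, -, c, hc, -, -, hca, -⟩ := T.matched
  obtain ⟨x, hx, hzx⟩ := T.exists_adj_of_mem_top hz
  obtain ⟨e, -, hez, hex, -⟩ := topGraph_adj_exists hzx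
  have hec : e ∈ Set.Iio c := by
    rw [T.Iio_eq_of_mem_bottom hc hz']
    exact hez
  rcases T.free.le_or_le hec hca x with h | h
  · rcases h.lt_or_eq with h | rfl
    · exact hex h
    · exact T.not_lt_of_mem_top hx hz hez
  · rcases h.lt_or_eq with h | rfl
    · exact T.not_lt_of_mem_top hx ha h
    · exact hex (lt_trans hec hca)

theorem not_top_lt_bottom {a b : T.Carrier} (ha : a ∈ T.top) (hb : b ∈ T.bottom) : ¬ a < b := by
  intro h
  obtain ⟨a', ha', -, -, c, hc, -, -, hca, -⟩ := T.matched
  have h' : b ∈ Set.Ioi a' := by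
    rw [T.Ioi_eq_of_mem_top ha' ha]
    exact h
  exact T.not_lt_of_mem_bottom hc hb (lt_trans hca h')

/-- The matching is a single `2 + 2`, but it spreads: walking through the top, the witnesses of
consecutive edges stay in one component of the bottom graph, so those of every edge lie in
`T.bottom`. -/
theorem mem_bottom_of_topGraph_adj {x y e : T.Carrier} (hx : x ∈ T.top)
    (hxy : (topGraph T.Carrier).Adj x y) (hex : e < x) (hey : ¬ e < y) : e ∈ T.bottom := by
  obtain ⟨a, ha, b, hb, c, hc, d, hd, hca, hdb, hab, hcd, had, hbc⟩ := T.matched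
  -- Here `w` is the vertex preceding `x` on the walk. The walk starts with the matched edge from
  -- `b` to `a`, with witnesses `d` and `c`.
  have key : ∃ w e f, e < w ∧ ¬ e < x ∧ f < x ∧ ¬ f < w ∧ f ∈ T.bottom := by
    have h := T.reachable_top ha hx
    rw [SimpleGraph.reachable_iff_reflTransGen] at h
    clear hex hey hxy hx
    induction h with
    | refl => exact ⟨b, d, c, hdb, had.not_gt, hca, hbc.not_gt, hc⟩
    | tail _ h ih =>
      obtain ⟨w, e, f, he, he', hf, hf', hfB⟩ := ih
      obtain ⟨e₁, f₁, h₁, h₂, h₃, h₄⟩ := topGraph_adj_exists h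
      have := reachable_of_topGraph_adj he he' hf hf' h₁ h₂ h₃ h₄
      exact ⟨_, e₁, f₁, h₁, h₂, h₃, h₄, T.mem_bottom_of_reachable hfB
        (this.trans (bottomGraph_adj_of_lt h₁ h₂ h₃ h₄).reachable)⟩
  obtain ⟨w, e₁, f₁, he, he', hf, hf', hfB⟩ := key
  obtain ⟨-, f, -, -, h₃, h₄⟩ := topGraph_adj_exists hxy
  exact T.mem_bottom_of_reachable hfB (reachable_of_topGraph_adj he he' hf hf' hex hey h₃ h₄)

/-- Membership cannot change along an edge from `x ∈ S` to `y ∉ S`: a bottom vertex `e` below `x`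
but not `y` would have to be below `y` if `e ∈ S`, and not below `x` otherwise. -/
theorem mem_of_isOrderInitial_top {S : Set T.Carrier} (hS : IsOrderInitial T.top T.bottom S)
    {a b : T.Carrier} (ha : a ∈ T.top) (hb : b ∈ T.top) (haS : a ∈ S) : b ∈ S := by
  have h := T.reachable_top ha hb
  rw [SimpleGraph.reachable_iff_reflTransGen] at h
  clear hb
  induction h with
  | refl => exact haS
  | @tail x y hx hxy ih =>
    by_contra hy
    rw [← SimpleGraph.reachable_iff_reflTransGen] at hx
    have hx := T.mem_top_of_reachable ha hx
    obtain ⟨e, -, hex, hey, -⟩ := topGraph_adj_exists hxy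
    have he := T.mem_bottom_of_topGraph_adj hx hxy hex hey
    by_cases heS : e ∈ S
    · exact hey ((hS e he y (T.mem_top_of_reachable hx hxy.reachable)).1 heS hy)
    · exact (hS e he x hx).2 heS ih hex

theorem mem_of_isOrderInitial_bottom {S : Set T.Carrier} (hS : IsOrderInitial T.top T.bottom S)
    {a b : T.Carrier} (ha : a ∈ T.bottom) (hb : b ∈ T.bottom) (haS : a ∈ S) : b ∈ S := by
  by_contra hbS
  exact T.dual.mem_of_isOrderInitial_top hS.dual hb ha hbS haS

theorem disjoint_or_subset_of_isOrderInitial {S : Set T.Carrier} (hS : IsOrderInitial T.top T.bottom S) :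
    Disjoint S (T.top ∪ T.bottom) ∨ T.top ∪ T.bottom ⊆ S := by
  obtain ⟨a, ha, b, hb, c, hc, d, hd, hca, hdb, hab, hcd, had, hbc⟩ := T.matched
  have h₁ := hS c hc b hb
  have h₂ := hS c hc a ha
  by_cases haS : a ∈ S
  · right
    have hcS : c ∈ S := by
      by_contra h
      exact h₂.2 h haS hca
    rintro x (hx | hx)
    · exact T.mem_of_isOrderInitial_top hS ha hx haS
    · exact T.mem_of_isOrderInitial_bottom hS hc hx hcS
  · left
    rw [Set.disjoint_left]
    rintro x hxS (hx | hx)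
    · exact haS (T.mem_of_isOrderInitial_top hS hx ha hxS)
    · have hcS := T.mem_of_isOrderInitial_bottom hS hx hc hxS
      exact hbc.not_gt (h₁.1 hcS fun h => haS (T.mem_of_isOrderInitial_top hS hb ha h))

end Tangle

/-! ### Tangles are the irreducible bicoloured graphs with at least two vertices -/

/-- Top and bottom are antichains and no top vertex is below a bottom one, so comparability and
colour determine the order. This is why passing to the bicoloured graph loses nothing. -/
theorem Tangle.lt_iff (T : Tangle) {v w : ↥(T.top ∪ T.bottom)} :
    v < w ↔ (v < w ∨ w < v) ∧ (v : T.Carrier) ∉ T.top ∧ (w : T.Carrier) ∈ T.top := by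
  have hlt : ∀ v w : ↥(T.top ∪ T.bottom), v < w →
      (v : T.Carrier) ∉ T.top ∧ (w : T.Carrier) ∈ T.top := by
    rintro ⟨v, hv⟩ ⟨w, hw⟩ h
    change v < w at h
    change v ∉ T.top ∧ w ∈ T.top
    have hv' : v ∉ T.top := by
      intro hv'
      rcases hw with hw | hw
      · exact T.not_lt_of_mem_top hv' hw h
      · exact T.not_top_lt_bottom hv' hw h
    refine ⟨hv', hw.resolve_right fun hw => ?_⟩
    exact T.not_lt_of_mem_bottom (hv.resolve_left hv') hw h
  constructor
  · exact fun h => ⟨.inl h, hlt v w h⟩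
  · rintro ⟨h | h, hv, hw⟩
    · exact h
    · exact absurd (hlt w v h).2 hv

theorem eq_of_eq_one_iff {i j : Fin 2} (h : i = 1 ↔ j = 1) : i = j := by
  revert i j
  decide

open Classical in
/-- The comparability graph of the vertices of a tangle; bottom vertices have colour `0` and top
vertices have colour `1`. -/
noncomputable def Tangle.toBicolouredGraph (T : Tangle) : BicolouredGraph where
  Vertex := ↥(T.top ∪ T.bottom)
  graph :=
    { Adj := fun v w => v < w ∨ w < v
      symm := ⟨fun _ _ h => h.symm⟩
      loopless := ⟨fun v h => h.elim (lt_irrefl v) (lt_irrefl v)⟩ }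
  colour := SimpleGraph.Coloring.mk (fun v => if (v : T.Carrier) ∈ T.top then 1 else 0) (by
    rintro v w (h | h)
    · obtain ⟨-, hv, hw⟩ := T.lt_iff.1 h
      simp [hv, hw]
    · obtain ⟨-, hv, hw⟩ := T.lt_iff.1 h
      simp [hv, hw])

namespace Tangle

theorem colour_eq_one_iff (T : Tangle) (v : ↥(T.top ∪ T.bottom)) :
    T.toBicolouredGraph.colour v = 1 ↔ (v : T.Carrier) ∈ T.top := by
  classical
  change (if (v : T.Carrier) ∈ T.top then (1 : Fin 2) else 0) = 1 ↔ _
  split_ifs with h <;> simp [h]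

theorem notMem_top_iff (T : Tangle) (v : ↥(T.top ∪ T.bottom)) :
    (v : T.Carrier) ∉ T.top ↔ (v : T.Carrier) ∈ T.bottom :=
  ⟨v.2.resolve_left, fun h h' => Set.disjoint_left.1 T.disjoint_top_bottom h' h⟩

theorem colour_eq_zero_iff (T : Tangle) (v : ↥(T.top ∪ T.bottom)) :
    T.toBicolouredGraph.colour v = 0 ↔ (v : T.Carrier) ∈ T.bottom := by
  rw [← notMem_top_iff, ← colour_eq_one_iff]
  generalize T.toBicolouredGraph.colour v = i
  revert i
  decide

theorem ncard_colourClass_one (T : Tangle) :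
    (T.toBicolouredGraph.colourClass 1).ncard = T.top.ncard :=
  Set.ncard_congr (fun (v : ↥(T.top ∪ T.bottom)) _ => (v : T.Carrier))
    (fun v hv => (T.colour_eq_one_iff v).1 hv) (fun _ _ _ _ h => Subtype.ext h)
    fun v hv => ⟨⟨v, .inl hv⟩, (T.colour_eq_one_iff _).2 hv, rfl⟩

theorem ncard_colourClass_zero (T : Tangle) :
    (T.toBicolouredGraph.colourClass 0).ncard = T.bottom.ncard :=
  Set.ncard_congr (fun (v : ↥(T.top ∪ T.bottom)) _ => (v : T.Carrier))
    (fun v hv => (T.colour_eq_zero_iff v).1 hv) (fun _ _ _ _ h => Subtype.ext h)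
    fun v hv => ⟨⟨v, .inr hv⟩, (T.colour_eq_zero_iff _).2 hv, rfl⟩

theorem nontrivial_vertex (T : Tangle) : Nontrivial T.toBicolouredGraph.Vertex :=
  (T.isTop.1.mono Set.subset_union_left).coe_sort

theorem isIrreducible (T : Tangle) : T.toBicolouredGraph.IsIrreducible := by
  refine ⟨T.nontrivial_vertex.to_nonempty, fun S hS => ?_⟩
  have h : IsOrderInitial T.top T.bottom (Subtype.val '' (S : Set ↥(T.top ∪ T.bottom))) := by
    intro b hb a ha
    have hlt : b < a ↔ T.toBicolouredGraph.graph.Adj (⟨b, .inr hb⟩ : ↥(T.top ∪ T.bottom))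
        (⟨a, .inl ha⟩ : ↥(T.top ∪ T.bottom)) := by
      refine ⟨fun h => .inl h, fun h => h.elim id fun h => ?_⟩
      exact absurd h (T.not_top_lt_bottom ha hb)
    have h0 := (T.colour_eq_zero_iff ⟨b, .inr hb⟩).2 hb
    have h1 := (T.colour_eq_one_iff ⟨a, .inl ha⟩).2 ha
    constructor
    · rintro ⟨b, hbS, rfl⟩ haS
      exact hlt.2 ((hS _ hbS _ fun h => haS ⟨_, h, rfl⟩).2 ⟨h0, h1⟩)
    · rintro hbS ⟨a, haS, rfl⟩ h
      have := (hS _ haS _ fun h => hbS ⟨_, h, rfl⟩).1 (hlt.1 h).symm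
      rw [h0] at this
      exact absurd this.2 (by decide)
  rcases T.disjoint_or_subset_of_isOrderInitial h with h | h
  · left
    exact Set.eq_empty_of_forall_notMem fun v hv => Set.disjoint_left.1 h ⟨v, hv, rfl⟩
      (Subtype.prop (p := (· ∈ T.top ∪ T.bottom)) v)
  · right
    refine Set.eq_univ_of_forall fun v => ?_
    obtain ⟨w, hw, hwv⟩ := h (Subtype.prop (p := (· ∈ T.top ∪ T.bottom)) v)
    rwa [← Subtype.ext hwv]

theorem iso_iff (S T : Tangle) : S.Iso T ↔ S.toBicolouredGraph.Iso T.toBicolouredGraph := by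
  constructor
  · rintro ⟨e, ht, -⟩
    refine ⟨⟨e.toEquiv, ?_⟩, fun v => ?_⟩
    · rintro (v : ↥(S.top ∪ S.bottom)) (w : ↥(S.top ∪ S.bottom))
      exact or_congr e.lt_iff_lt e.lt_iff_lt
    · exact eq_of_eq_one_iff
        ((T.colour_eq_one_iff (e v)).trans ((ht v).trans (S.colour_eq_one_iff v).symm))
  · rintro ⟨e, he⟩
    let f : ↥(S.top ∪ S.bottom) ≃ ↥(T.top ∪ T.bottom) := e.toEquiv
    have ht : ∀ v, (f v : T.Carrier) ∈ T.top ↔ (v : S.Carrier) ∈ S.top := fun v => by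
      rw [← colour_eq_one_iff, ← colour_eq_one_iff, ← he v]
      rfl
    have hb : ∀ v, (f v : T.Carrier) ∈ T.bottom ↔ (v : S.Carrier) ∈ S.bottom := fun v => by
      rw [← notMem_top_iff, ← notMem_top_iff, ht]
    have hadj : ∀ v w, (f v < f w ∨ f w < f v) ↔ (v < w ∨ w < v) := fun v w => e.map_rel_iff
    refine ⟨⟨f, ?_⟩, ht, hb⟩
    intro v w
    rw [le_iff_eq_or_lt, le_iff_eq_or_lt, f.apply_eq_iff_eq, T.lt_iff, S.lt_iff, hadj, ht, ht]

end Tangle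

/-! ### Irreducibility forces the top to be one component. -/

theorem eq_empty_or_eq_empty_of_Iio_subset {P : Type} [PartialOrder P] {A B L U : Set P}
    (hAB : Disjoint A B) (hB : ∀ a ∈ A, ∀ b, b < a → b ∈ B)
    (hirr : ∀ S, IsOrderInitial A B S → S = ∅ ∨ S = Set.univ)
    (hA : L ∪ U = A) (hd : Disjoint L U) (h : ∀ l ∈ L, ∀ u ∈ U, Set.Iio l ⊆ Set.Iio u) :
    L = ∅ ∨ U = ∅ := by
  subst hA
  -- A cut of `A` compatible with inclusion of downsets yields an initial set: `L` together with
  -- everything below it.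
  have hS : IsOrderInitial (L ∪ U) B (L ∪ {b | ∃ l ∈ L, b < l}) := by
    intro b hb a ha
    refine ⟨fun h₁ h₂ => ?_, fun h₁ h₂ hba => ?_⟩
    · rcases h₁ with h₁ | ⟨l, hl, hbl⟩
      · exact absurd hb (Set.disjoint_left.1 hAB (.inl h₁))
      · exact h l hl a (ha.resolve_left fun h => h₂ (.inl h)) hbl
    · rcases h₂ with h₂ | ⟨l, hl, hal⟩
      · exact h₁ (.inr ⟨a, h₂, hba⟩)
      · exact Set.disjoint_left.1 hAB ha (hB l (.inl hl) a hal)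
  rcases hirr _ hS with h' | h'
  · exact .inl (Set.union_empty_iff.1 h').1
  · right
    refine Set.eq_empty_of_forall_notMem fun u hu => ?_
    rcases Set.eq_univ_iff_forall.1 h' u with hu' | ⟨l, hl, hul⟩
    · exact Set.disjoint_left.1 hd hu' hu
    · exact Set.disjoint_left.1 hAB (.inr hu) (hB l (.inl hl) u hul)

/-- The downset of `x` is comparable with all those in another component. It cannot switch sides
along an edge, since it would then lie between two incomparable downsets. -/
theorem Iio_subset_of_reachable {P : Type} [PartialOrder P] {a c x : P}
    (h : (topGraph P).Reachable a c) (hx : ¬ (topGraph P).Reachable a x) :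
    (Set.Iio a ⊆ Set.Iio x → Set.Iio c ⊆ Set.Iio x) ∧
      (Set.Iio x ⊆ Set.Iio a → Set.Iio x ⊆ Set.Iio c) := by
  rw [SimpleGraph.reachable_iff_reflTransGen] at h
  induction h with
  | refl => exact ⟨id, id⟩
  | @tail b c hab hbc ih =>
    rw [← SimpleGraph.reachable_iff_reflTransGen] at hab
    have hc : ¬ (topGraph P).Adj c x := fun h =>
      hx ((hab.trans hbc.reachable).trans h.reachable)
    have hc' : Set.Iio c ⊆ Set.Iio x ∨ Set.Iio x ⊆ Set.Iio c := by
      by_contra! h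
      exact hc h
    constructor
    · intro h
      exact hc'.resolve_right fun h' => hbc.1 ((ih.1 h).trans h')
    · intro h
      exact hc'.resolve_left fun h' => hbc.2 (h'.trans (ih.2 h))

theorem reachable_of_forall_isOrderInitial {P : Type} [PartialOrder P] {A B : Set P}
    (hAB : Disjoint A B) (hB : ∀ a ∈ A, ∀ b, b < a → b ∈ B)
    (hirr : ∀ S, IsOrderInitial A B S → S = ∅ ∨ S = Set.univ) {a b : P} (ha : a ∈ A)
    (hb : b ∈ A) : (topGraph P).Reachable a b := by
  by_contra hab
  let R : Set P := {x | (topGraph P).Reachable a x}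
  let U : Set P := {x ∈ A | x ∉ R ∧ Set.Iio a ⊆ Set.Iio x}
  -- `U` collects the vertices outside the component `R` of `a` that lie above it. Cutting `A` just
  -- below `U` shows that `U` is empty; then everything outside `R` lies below it, and cutting just
  -- below `R` gives the contradiction.
  have hU : U = ∅ := by
    refine (eq_empty_or_eq_empty_of_Iio_subset hAB hB hirr (L := A \ U) (U := U)
      (Set.sdiff_union_of_subset fun x hx => hx.1) Set.disjoint_sdiff_left ?_).resolve_left ?_
    · rintro l ⟨hl, hlU⟩ u ⟨hu, huR, hau⟩
      by_cases hlR : l ∈ R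
      · exact (Iio_subset_of_reachable hlR huR).1 hau
      · have h₁ : ¬ Set.Iio a ⊆ Set.Iio l := fun h => hlU ⟨hl, hlR, h⟩
        have h₂ : Set.Iio l ⊆ Set.Iio a := by
          by_contra h₂
          exact hlR (SimpleGraph.Adj.reachable ⟨h₁, h₂⟩)
        exact h₂.trans hau
    · exact Set.Nonempty.ne_empty ⟨a, ha, fun h => h.2.1 (SimpleGraph.Reachable.refl a)⟩
  have hsub : ∀ l ∈ A \ R, ∀ u ∈ A ∩ R, Set.Iio l ⊆ Set.Iio u := by
    rintro l ⟨hl, hlR⟩ u ⟨hu, huR⟩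
    refine (Iio_subset_of_reachable huR hlR).2 ?_
    have h₁ : ¬ Set.Iio a ⊆ Set.Iio l := fun h =>
      Set.eq_empty_iff_forall_notMem.1 hU l ⟨hl, hlR, h⟩
    by_contra h₂
    exact hlR (SimpleGraph.Adj.reachable ⟨h₁, h₂⟩)
  rcases eq_empty_or_eq_empty_of_Iio_subset hAB hB hirr (Set.sdiff_union_inter A R)
    Set.disjoint_sdiff_inter hsub with h | h
  · exact Set.eq_empty_iff_forall_notMem.1 h b ⟨hb, hab⟩
  · exact Set.eq_empty_iff_forall_notMem.1 h a ⟨ha, SimpleGraph.Reachable.refl a⟩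

theorem nontrivial_of_forall_isOrderInitial {P : Type} [PartialOrder P] [Nontrivial P]
    {A B : Set P} (hAB : Disjoint A B)
    (hirr : ∀ S, IsOrderInitial A B S → S = ∅ ∨ S = Set.univ) : A.Nontrivial := by
  by_contra hA
  rw [Set.not_nontrivial_iff] at hA
  -- If `A` has at most one element, some singleton is initial: `{b}` if `b ∈ B` is below the only
  -- element of `A`, otherwise `{a}` for that element, or any singleton if `A` is empty.
  have hs : ∀ v : P, ¬ IsOrderInitial A B {v} := by
    intro v hv
    rcases hirr _ hv with h | h
    · exact Set.singleton_ne_empty v h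
    · obtain ⟨w, hw⟩ := exists_ne v
      exact hw (Set.eq_univ_iff_forall.1 h w)
  by_cases h : ∃ b ∈ B, ∃ a ∈ A, b < a
  · obtain ⟨b, hb, a, ha, hba⟩ := h
    refine hs b fun b' hb' a' ha' => ⟨fun h₁ _ => ?_, fun _ h₂ => ?_⟩
    · rwa [hA ha' ha, Set.mem_singleton_iff.1 h₁]
    · rw [Set.mem_singleton_iff.1 h₂] at ha'
      exact absurd hb (Set.disjoint_left.1 hAB ha')
  push Not at h
  rcases A.eq_empty_or_nonempty with rfl | ⟨a, ha⟩
  · exact hs (Classical.arbitrary P) fun _ _ _ h => absurd h (Set.notMem_empty _)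
  · refine hs a fun b hb a' ha' => ⟨fun h₁ _ => ?_, fun _ _ => h b hb a' ha'⟩
    rw [Set.mem_singleton_iff.1 h₁] at hb
    exact absurd hb (Set.disjoint_left.1 hAB ha)

theorem isTangleTop_of_forall_isOrderInitial {P : Type} [PartialOrder P] [Nontrivial P]
    {A B : Set P} (hAB : Disjoint A B) (hB : ∀ a ∈ A, ∀ b, b < a → b ∈ B)
    (hA : ∀ a b, b < a → a ∈ A)
    (hirr : ∀ S, IsOrderInitial A B S → S = ∅ ∨ S = Set.univ) : IsTangleTop A := by
  have hn := nontrivial_of_forall_isOrderInitial hAB hirr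
  obtain ⟨a, ha⟩ := hn.nonempty
  refine ⟨hn, (topGraph P).connectedComponentMk a, ?_⟩
  ext x
  rw [SimpleGraph.ConnectedComponent.mem_supp_iff, SimpleGraph.ConnectedComponent.eq]
  refine ⟨fun h => ?_, fun h => reachable_of_forall_isOrderInitial hAB hB hirr h ha⟩
  have h := h.symm
  rw [SimpleGraph.reachable_iff_reflTransGen] at h
  rcases h.cases_tail with rfl | ⟨y, -, hy⟩
  · exact ha
  · obtain ⟨c, hc, -⟩ := Set.not_subset.1 hy.2
    exact hA x c hc

/-! ### The tangle of an irreducible bicoloured graph. -/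

namespace BicolouredGraph

/-- The poset of height at most two in which a vertex `v` of colour `0` is below a vertex `w` of
colour `1` if they are adjacent. -/
@[reducible]
def poset (G : BicolouredGraph) : PartialOrder G.Vertex where
  le v w := v = w ∨ G.graph.Adj v w ∧ G.colour v = 0 ∧ G.colour w = 1
  le_refl v := .inl rfl
  le_trans := by
    rintro u v w (rfl | ⟨h, hu, hv⟩) (rfl | ⟨h', hv', hw⟩)
    · exact .inl rfl
    · exact .inr ⟨h', hv', hw⟩
    · exact .inr ⟨h, hu, hv⟩
    · rw [hv] at hv'
      exact absurd hv' (by decide)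
  le_antisymm := by
    rintro v w (rfl | ⟨h, hv, hw⟩) (h' | ⟨-, hw', -⟩)
    · rfl
    · rfl
    · exact h'.symm
    · rw [hw] at hw'
      exact absurd hw' (by decide)

theorem poset_lt_iff (G : BicolouredGraph) {v w : G.Vertex} :
    G.poset.lt v w ↔ G.graph.Adj v w ∧ G.colour v = 0 ∧ G.colour w = 1 := by
  let := G.poset
  change v < w ↔ _
  rw [lt_iff_le_and_ne]
  constructor
  · rintro ⟨h | h, hne⟩
    · exact absurd h hne
    · exact h
  · rintro h
    exact ⟨.inr h, h.1.ne⟩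

theorem isInitial_of_isOrderInitial (G : BicolouredGraph) {S : Set G.Vertex}
    (hS : @IsOrderInitial _ G.poset (G.colourClass 1) (G.colourClass 0) S) :
    G.IsInitial S := by
  intro v hv w hw
  have h01 : ∀ i : Fin 2, i = 0 ∨ i = 1 := by decide
  rcases h01 (G.colour v) with hv' | hv' <;> rcases h01 (G.colour w) with hw' | hw'
  · simp [G.not_adj_of_colour_eq (hv'.trans hw'.symm), hw']
  · have h := G.poset_lt_iff.1 ((hS v hv' w hw').1 hv hw)
    simp [h]
  · simp only [hv', one_ne_zero, false_and, iff_false]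
    intro h
    exact (hS w hw' v hv').2 hw hv (G.poset_lt_iff.2 ⟨h.symm, hw', hv'⟩)
  · simp [G.not_adj_of_colour_eq (hv'.trans hw'.symm), hv']

theorem disjoint_colourClass (G : BicolouredGraph) :
    Disjoint (G.colourClass 1) (G.colourClass 0) := by
  rw [Set.disjoint_left]
  intro v (hv : G.colour v = 1) (hv' : G.colour v = 0)
  rw [hv] at hv'
  exact absurd hv' (by decide)

/-- The tangle on the vertices of an irreducible bicoloured graph with at least two vertices. -/
def toTangle (G : BicolouredGraph) [Nontrivial G.Vertex] (hG : G.IsIrreducible) : Tangle :=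
  letI := G.poset
  have hlt : ∀ {v w : G.Vertex}, v < w ↔ G.graph.Adj v w ∧ G.colour v = 0 ∧ G.colour w = 1 :=
    G.poset_lt_iff
  have hirr : ∀ S, IsOrderInitial (G.colourClass 1) (G.colourClass 0) S → S = ∅ ∨ S = Set.univ :=
    fun S hS => hG.2 S (G.isInitial_of_isOrderInitial hS)
  have htop : IsTangleTop (G.colourClass 1) :=
    isTangleTop_of_forall_isOrderInitial G.disjoint_colourClass
      (fun _ _ _ h => (hlt.1 h).2.1) (fun _ _ h => (hlt.1 h).2.2) hirr
  { Carrier := G.Vertex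
    order := G.poset
    free := by
      rintro ⟨a, b, c, d, hab, hbc, -⟩
      have h := (hlt.1 hab).2.2
      rw [(hlt.1 hbc).2.1] at h
      exact absurd h (by decide)
    top := G.colourClass 1
    bottom := G.colourClass 0
    isTop := htop
    isBottom := by
      refine isTangleTop_of_forall_isOrderInitial (P := G.Vertexᵒᵈ) (A := G.colourClass 0)
        (B := G.colourClass 1) G.disjoint_colourClass.symm
        (fun _ _ _ h => (hlt.1 h).2.2) (fun _ _ h => (hlt.1 h).2.1) fun S hS => ?_
      rcases hirr _ hS.dual with h | h
      · exact .inr (Set.compl_empty_iff.1 h)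
      · exact .inl (Set.compl_univ_iff.1 h)
    matched := by
      obtain ⟨a, ha, b, hb, hab⟩ := htop.1
      have h := reachable_of_forall_isOrderInitial G.disjoint_colourClass
        (fun _ _ _ h => (hlt.1 h).2.1) hirr ha hb
      rw [SimpleGraph.reachable_iff_reflTransGen] at h
      -- In this height-two poset, any edge of the top graph together with its two witnesses is
      -- already an induced `2 + 2`.
      rcases h.cases_head with h | ⟨x, h, -⟩
      · exact absurd h hab
      obtain ⟨c, d, hca, hcx, hdx, hda⟩ := topGraph_adj_exists h
      have key : ∀ v w : G.Vertex, ¬ v < w → ¬ w < v → v ≠ w → IncompRel (· ≤ ·) v w :=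
        fun v w h₁ h₂ h₃ => ⟨fun h => h₁ (h.lt_of_ne h₃), fun h => h₂ (h.lt_of_ne h₃.symm)⟩
      have hd := (hlt.1 hdx).2.1
      have hc := (hlt.1 hca).2.1
      have hx := (hlt.1 hdx).2.2
      have ha : G.colour a = 1 := ha
      have hn : ∀ {v w : G.Vertex}, G.colour v = 1 → ¬ v < w := fun hv h => by
        rw [(hlt.1 h).2.1] at hv
        exact absurd hv (by decide)
      have hn' : ∀ {v w : G.Vertex}, G.colour w = 0 → ¬ v < w := fun hv h => by
        rw [(hlt.1 h).2.2] at hv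
        exact absurd hv (by decide)
      refine ⟨a, ha, x, hx, c, hc, d, hd, hca, hdx, key _ _ (hn ha) (hn hx) h.ne,
        key _ _ (hn' hd) (hn' hc) ?_, key _ _ (hn ha) hda ?_, key _ _ (hn hx) hcx ?_⟩
      · rintro rfl
        exact hcx hdx
      · rintro rfl
        rw [ha] at hd
        exact absurd hd (by decide)
      · rintro rfl
        rw [hx] at hc
        exact absurd hc (by decide) }

theorem toTangle_iso (G : BicolouredGraph) [Nontrivial G.Vertex] (hG : G.IsIrreducible) :
    (G.toTangle hG).toBicolouredGraph.Iso G := by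
  have h01 : ∀ i : Fin 2, i ≠ 1 → i = 0 := by decide
  have hu : ∀ v, v ∈ G.colourClass 1 ∪ G.colourClass 0 := fun v => by
    by_cases h : G.colour v = 1
    · exact .inl h
    · exact .inr (h01 _ h)
  refine ⟨⟨Equiv.subtypeUnivEquiv hu, ?_⟩, ?_⟩
  · rintro ⟨v, hv⟩ ⟨w, hw⟩
    change G.graph.Adj v w ↔ G.poset.lt v w ∨ G.poset.lt w v
    refine Iff.trans ?_ (or_congr G.poset_lt_iff G.poset_lt_iff).symm
    refine ⟨fun h => ?_, fun h => h.elim And.left fun h => h.1.symm⟩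
    have hc : ∀ i j : Fin 2, i ≠ j → i = 0 ∧ j = 1 ∨ j = 0 ∧ i = 1 := by decide
    exact (hc _ _ (G.colour.valid h)).imp (And.intro h) (And.intro h.symm)
  · intro v
    exact eq_of_eq_one_iff ((G.toTangle hG).colour_eq_one_iff v).symm

end BicolouredGraph

/-! ### Counting -/

open BicolouredGraph

theorem mk_mem_unlabelledBicolouredGraphs {G : BicolouredGraph} {i j : ℕ} :
    Quotient.mk BicolouredGraph.setoid G ∈ unlabelledBicolouredGraphs i j ↔
      (G.colourClass 0).ncard = i ∧ (G.colourClass 1).ncard = j := by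
  refine ⟨?_, fun h => ⟨G, h, rfl⟩⟩
  rintro ⟨H, ⟨h₀, h₁⟩, h⟩
  have h := Quotient.exact h
  exact ⟨(ncard_colourClass_of_iso h 0).symm.trans h₀, (ncard_colourClass_of_iso h 1).symm.trans h₁⟩

/-- The isomorphism classes of irreducible bicoloured graphs with `i` vertices of colour `0` and
`j` vertices of colour `1`. -/
def unlabelledIrreducibles (i j : ℕ) : Set UnlabelledBicolouredGraph :=
  Quotient.mk BicolouredGraph.setoid '' {G | G.IsIrreducible} ∩ unlabelledBicolouredGraphs i j

theorem finite_unlabelledIrreducibles (i j : ℕ) : (unlabelledIrreducibles i j).Finite :=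
  (finite_unlabelledBicolouredGraphs i j).subset Set.inter_subset_right

theorem mk_mem_unlabelledIrreducibles {G : BicolouredGraph} {i j : ℕ} :
    Quotient.mk BicolouredGraph.setoid G ∈ unlabelledIrreducibles i j ↔
      G.IsIrreducible ∧ (G.colourClass 0).ncard = i ∧ (G.colourClass 1).ncard = j := by
  rw [unlabelledIrreducibles, Set.mem_inter_iff, mk_mem_unlabelledBicolouredGraphs]
  refine and_congr_left fun _ => ⟨?_, fun h => ⟨G, h, rfl⟩⟩
  rintro ⟨H, hH, h⟩
  exact hH.of_iso (Quotient.exact h)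

/-- Composition of isomorphism classes of bicoloured graphs. -/
def UnlabelledBicolouredGraph.comp :
    UnlabelledBicolouredGraph → UnlabelledBicolouredGraph → UnlabelledBicolouredGraph :=
  Quotient.map₂ BicolouredGraph.comp fun _ _ hG _ _ hH => comp_congr hG hH

theorem card_vertex (G : BicolouredGraph) :
    Nat.card G.Vertex = (G.colourClass 0).ncard + (G.colourClass 1).ncard := by
  have h01 : ∀ i : Fin 2, i ≠ 1 → i = 0 := by decide
  rw [add_comm, ← Set.ncard_union_eq G.disjoint_colourClass, ← Set.ncard_univ]
  congr 1
  refine (Set.eq_univ_of_forall fun v => ?_).symm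
  by_cases h : G.colour v = 1
  · exact .inl h
  · exact .inr (h01 _ h)

theorem ncard_unlabelledBicolouredGraphs {n : Fin 2 →₀ ℕ} (hn : n ≠ 0) :
    (unlabelledBicolouredGraphs (n 0) (n 1)).ncard =
      ∑ p ∈ Finset.HasAntidiagonal.antidiagonal n, (unlabelledIrreducibles (p.1 0) (p.1 1)).ncard *
        (unlabelledBicolouredGraphs (p.2 0) (p.2 1)).ncard := by
  classical
  simp only [Set.ncard_eq_toFinset_card _ (finite_unlabelledBicolouredGraphs _ _),
    Set.ncard_eq_toFinset_card _ (finite_unlabelledIrreducibles _ _), ← Finset.card_product]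
  rw [← Finset.card_sigma]
  symm
  -- Injectivity is uniqueness of the factorisation, which also recovers the sizes `p`; surjectivity
  -- is its existence, where `n ≠ 0` makes the graph nonempty.
  refine Finset.card_bij (fun x _ => UnlabelledBicolouredGraph.comp x.2.1 x.2.2) ?_ ?_ ?_
  · rintro ⟨p, g, h⟩ hx
    induction g, h using Quotient.inductionOn₂ with | _ G H
    simp only [Finset.mem_sigma, Finset.HasAntidiagonal.mem_antidiagonal, Finset.mem_product,
      Set.Finite.mem_toFinset, mk_mem_unlabelledIrreducibles,
      mk_mem_unlabelledBicolouredGraphs] at hx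
    obtain ⟨rfl, ⟨-, h₁, h₂⟩, h₃, h₄⟩ := hx
    rw [Set.Finite.mem_toFinset]
    refine mk_mem_unlabelledBicolouredGraphs.2 ?_
    rw [ncard_colourClass_comp, ncard_colourClass_comp, h₁, h₂, h₃, h₄]
    exact ⟨rfl, rfl⟩
  · rintro ⟨⟨p, q⟩, g, h⟩ hx ⟨⟨p', q'⟩, g', h'⟩ hx' heq
    induction g, h using Quotient.inductionOn₂ with | _ G H
    induction g', h' using Quotient.inductionOn₂ with | _ G' H'
    simp only [Finset.mem_sigma, Finset.HasAntidiagonal.mem_antidiagonal, Finset.mem_product,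
      Set.Finite.mem_toFinset, mk_mem_unlabelledIrreducibles,
      mk_mem_unlabelledBicolouredGraphs] at hx hx'
    obtain ⟨-, ⟨hG, h₁, h₂⟩, h₃, h₄⟩ := hx
    obtain ⟨-, ⟨hG', h₁', h₂'⟩, h₃', h₄'⟩ := hx'
    obtain ⟨hGG, hHH⟩ := iso_of_comp_iso hG hG' (Quotient.exact heq)
    have hp : p = p' := by
      ext k
      fin_cases k
      · exact h₁.symm.trans ((ncard_colourClass_of_iso hGG 0).trans h₁')
      · exact h₂.symm.trans ((ncard_colourClass_of_iso hGG 1).trans h₂')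
    have hq : q = q' := by
      ext k
      fin_cases k
      · exact h₃.symm.trans ((ncard_colourClass_of_iso hHH 0).trans h₃')
      · exact h₄.symm.trans ((ncard_colourClass_of_iso hHH 1).trans h₄')
    have hg := Quotient.sound (s := BicolouredGraph.setoid) hGG
    have hh := Quotient.sound (s := BicolouredGraph.setoid) hHH
    rw [hp, hq, hg, hh]
  · intro g hg
    induction g using Quotient.inductionOn with | _ G
    rw [Set.Finite.mem_toFinset, mk_mem_unlabelledBicolouredGraphs] at hg
    have hne : Nonempty G.Vertex := by
      by_contra h
      rw [not_nonempty_iff] at h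
      have hc := card_vertex G
      rw [Nat.card_of_isEmpty, hg.1, hg.2] at hc
      refine hn (Finsupp.ext fun k => ?_)
      fin_cases k
      · change n 0 = 0
        omega
      · change n 1 = 0
        omega
    obtain ⟨H, K, hH, hHK⟩ := exists_iso_comp G hne
    have hk : ∀ k, (H.colourClass k).ncard + (K.colourClass k).ncard = (G.colourClass k).ncard :=
      fun k => (ncard_colourClass_comp H K k).symm.trans (ncard_colourClass_of_iso hHK k)
    let d : BicolouredGraph → Fin 2 →₀ ℕ := fun G =>
      Finsupp.equivFunOnFinite.symm fun k => (G.colourClass k).ncard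
    refine ⟨⟨(d H, d K), Quotient.mk _ H, Quotient.mk _ K⟩, ?_, Quotient.sound hHK⟩
    simp only [Finset.mem_sigma, Finset.HasAntidiagonal.mem_antidiagonal, Finset.mem_product,
      Set.Finite.mem_toFinset, mk_mem_unlabelledIrreducibles,
      mk_mem_unlabelledBicolouredGraphs]
    refine ⟨Finsupp.ext fun k => ?_, ⟨hH, rfl, rfl⟩, rfl, rfl⟩
    refine (hk k).trans ?_
    fin_cases k
    · exact hg.1
    · exact hg.2

/-! ### Sizes zero and one, and the comparison of tangles with irreducibles. -/

theorem ncard_unlabelledBicolouredGraphs_zero : (unlabelledBicolouredGraphs 0 0).ncard = 1 := by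
  let E : BicolouredGraph := ⟨Empty, ⊥, SimpleGraph.Coloring.mk Empty.elim fun {v} => v.elim⟩
  have hE : Quotient.mk BicolouredGraph.setoid E ∈ unlabelledBicolouredGraphs 0 0 := by
    have h : ∀ k, E.colourClass k = ∅ := fun k => Set.eq_empty_of_forall_notMem fun v => v.elim
    rw [mk_mem_unlabelledBicolouredGraphs, h, h, Set.ncard_empty]
    exact ⟨rfl, rfl⟩
  rw [Set.ncard_eq_one]
  refine ⟨_, Set.eq_singleton_iff_unique_mem.2 ⟨hE, fun g hg => ?_⟩⟩
  induction g using Quotient.inductionOn with | _ G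
  rw [mk_mem_unlabelledBicolouredGraphs] at hg
  have hG : IsEmpty G.Vertex := by
    rw [← Finite.card_eq_zero_iff, card_vertex, hg.1, hg.2]
  exact Quotient.sound ⟨⟨Equiv.equivOfIsEmpty _ _, fun {v} => hG.elim v⟩, fun v => hG.elim v⟩

theorem unlabelledIrreducibles_zero : unlabelledIrreducibles 0 0 = ∅ := by
  refine Set.eq_empty_of_forall_notMem fun g hg => ?_
  induction g using Quotient.inductionOn with | _ G
  rw [mk_mem_unlabelledIrreducibles] at hg
  obtain ⟨hG, h₀, h₁⟩ := hg
  have hc := card_vertex G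
  rw [h₀, h₁, Finite.card_eq_zero_iff] at hc
  exact hc.elim hG.1.some

/-- The bicoloured graph with one vertex, of colour `k`. -/
def BicolouredGraph.point (k : Fin 2) : BicolouredGraph :=
  ⟨Unit, ⊥, SimpleGraph.Coloring.mk (fun _ => k) fun h => absurd h id⟩

theorem BicolouredGraph.isIrreducible_point (k : Fin 2) : (point k).IsIrreducible :=
  ⟨⟨()⟩, fun S _ => (S : Set Unit).eq_empty_or_nonempty.imp id (Set.Nonempty.eq_univ (α := Unit))⟩

theorem BicolouredGraph.ncard_colourClass_point (k l : Fin 2) :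
    ((point k).colourClass l).ncard = if k = l then 1 else 0 := by
  split_ifs with h
  · have : (point k).colourClass l = (Set.univ : Set Unit) := Set.eq_univ_of_forall fun _ => h
    rw [this]
    exact (Set.ncard_univ Unit).trans Nat.card_unique
  · have : (point k).colourClass l = ∅ := Set.eq_empty_of_forall_notMem fun _ h' => h h'
    rw [this, Set.ncard_empty]

theorem BicolouredGraph.iso_point (G : BicolouredGraph) (k : Fin 2) (h : Nat.card G.Vertex = 1)
    (hk : (G.colourClass k).ncard ≠ 0) : G.Iso (point k) := by
  obtain ⟨hs, ⟨v⟩⟩ := Nat.card_eq_one_iff_unique.1 h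
  obtain ⟨w, hw⟩ := Set.nonempty_of_ncard_ne_zero hk
  refine ⟨⟨⟨fun _ => (), fun _ => v, fun _ => Subsingleton.elim _ _, fun _ => rfl⟩, ?_⟩, ?_⟩
  · intro a b
    refine ⟨fun h => absurd h id, fun h => absurd (Subsingleton.elim a b) h.ne⟩
  · intro a
    rw [Subsingleton.elim a w]
    exact hw.symm

theorem ncard_unlabelledIrreducibles_one_zero : (unlabelledIrreducibles 1 0).ncard = 1 := by
  rw [Set.ncard_eq_one]
  refine ⟨_, Set.eq_singleton_iff_unique_mem.2
    ⟨mk_mem_unlabelledIrreducibles.2 ⟨isIrreducible_point 0, ?_, ?_⟩, fun g hg => ?_⟩⟩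
  · exact ncard_colourClass_point 0 0
  · exact ncard_colourClass_point 0 1
  induction g using Quotient.inductionOn with | _ G
  obtain ⟨-, h₀, h₁⟩ := mk_mem_unlabelledIrreducibles.1 hg
  exact Quotient.sound (G.iso_point 0 (by rw [card_vertex, h₀, h₁]) (by omega))

theorem ncard_unlabelledIrreducibles_zero_one : (unlabelledIrreducibles 0 1).ncard = 1 := by
  rw [Set.ncard_eq_one]
  refine ⟨_, Set.eq_singleton_iff_unique_mem.2
    ⟨mk_mem_unlabelledIrreducibles.2 ⟨isIrreducible_point 1, ?_, ?_⟩, fun g hg => ?_⟩⟩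
  · exact ncard_colourClass_point 1 0
  · exact ncard_colourClass_point 1 1
  induction g using Quotient.inductionOn with | _ G
  obtain ⟨-, h₀, h₁⟩ := mk_mem_unlabelledIrreducibles.1 hg
  exact Quotient.sound (G.iso_point 1 (by rw [card_vertex, h₀, h₁]) (by omega))

theorem unlabelledTangles_eq_empty {i j : ℕ} (h : i < 2 ∨ j < 2) :
    unlabelledTangles i j = ∅ := by
  refine Set.eq_empty_of_forall_notMem ?_
  rintro _ ⟨T, ⟨rfl, rfl⟩, -⟩
  have h₁ := Set.one_lt_ncard_iff_nontrivial.2 T.isTop.1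
  have h₂ := Set.one_lt_ncard_iff_nontrivial.2 T.isBottom.1
  omega

theorem ncard_unlabelledTangles {i j : ℕ} (h : 2 ≤ i + j) :
    (unlabelledTangles i j).ncard = (unlabelledIrreducibles i j).ncard := by
  let f : UnlabelledTangle → UnlabelledBicolouredGraph :=
    Quotient.map Tangle.toBicolouredGraph fun S T hST => (S.iso_iff T).1 hST
  have hf : Function.Injective f := by
    intro s t hst
    induction s, t using Quotient.inductionOn₂ with | _ S T
    exact Quotient.sound ((S.iso_iff T).2 (Quotient.exact hst))
  rw [← Set.ncard_image_of_injective _ hf]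
  congr 1
  ext g
  constructor
  · rintro ⟨_, ⟨T, ⟨hi, hj⟩, rfl⟩, rfl⟩
    exact mk_mem_unlabelledIrreducibles.2
      ⟨T.isIrreducible, T.ncard_colourClass_zero.trans hi, T.ncard_colourClass_one.trans hj⟩
  · intro hg
    induction g using Quotient.inductionOn with | _ G
    obtain ⟨hG, h₀, h₁⟩ := mk_mem_unlabelledIrreducibles.1 hg
    have : Nontrivial G.Vertex := by
      rw [← Finite.one_lt_card_iff_nontrivial, card_vertex, h₀, h₁]
      exact h
    exact ⟨_, ⟨G.toTangle hG, ⟨h₀, h₁⟩, rfl⟩, Quotient.sound (G.toTangle_iso hG)⟩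

/-! ### Generating functions -/

theorem coeff_X_add_X_add_tangleGF (n : Fin 2 →₀ ℕ) :
    MvPowerSeries.coeff n (MvPowerSeries.X 0 + MvPowerSeries.X 1 + tangleGF) =
      ((unlabelledIrreducibles (n 0) (n 1)).ncard : ℚ) := by
  classical
  have hT : MvPowerSeries.coeff n tangleGF = ((unlabelledTangles (n 0) (n 1)).ncard : ℚ) := rfl
  rw [map_add, map_add, MvPowerSeries.coeff_X, MvPowerSeries.coeff_X, hT]
  have h₀ : n = Finsupp.single 0 1 ↔ n 0 = 1 ∧ n 1 = 0 := by
    simp [Finsupp.ext_iff, Fin.forall_fin_two]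
  have h₁ : n = Finsupp.single 1 1 ↔ n 0 = 0 ∧ n 1 = 1 := by
    simp [Finsupp.ext_iff, Fin.forall_fin_two]
  rw [if_congr h₀ rfl rfl, if_congr h₁ rfl rfl]
  generalize n 0 = i
  generalize n 1 = j
  -- Tangles have at least two vertices on each side, so they contribute nothing in total size below
  -- two, where `x + y` accounts for the one-vertex irreducibles.
  by_cases h : 2 ≤ i + j
  · rw [if_neg (by omega), if_neg (by omega), ncard_unlabelledTangles h, zero_add, zero_add]
  rw [unlabelledTangles_eq_empty (by omega)]
  have : i = 0 ∧ j = 0 ∨ i = 1 ∧ j = 0 ∨ i = 0 ∧ j = 1 := by omega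
  rcases this with ⟨rfl, rfl⟩ | ⟨rfl, rfl⟩ | ⟨rfl, rfl⟩
  · simp [unlabelledIrreducibles_zero]
  · simp [ncard_unlabelledIrreducibles_one_zero]
  · simp [ncard_unlabelledIrreducibles_zero_one]

theorem bicolouredGF_eq :
    bicolouredGF = 1 + (MvPowerSeries.X 0 + MvPowerSeries.X 1 + tangleGF) * bicolouredGF := by
  classical
  have hB : ∀ n, MvPowerSeries.coeff n bicolouredGF =
    ((unlabelledBicolouredGraphs (n 0) (n 1)).ncard : ℚ) := fun _ => rfl
  ext n
  rw [map_add, MvPowerSeries.coeff_one, MvPowerSeries.coeff_mul]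
  simp only [coeff_X_add_X_add_tangleGF, hB]
  split_ifs with hn
  · subst hn
    simp [ncard_unlabelledBicolouredGraphs_zero, unlabelledIrreducibles_zero]
  · rw [ncard_unlabelledBicolouredGraphs hn, zero_add]
    push_cast
    rfl

theorem mul_bicolouredGF :
    (1 - MvPowerSeries.X 0 - MvPowerSeries.X 1 - tangleGF) * bicolouredGF = 1 := by
  linear_combination bicolouredGF_eq

end Tangles

theorem mainTheorem7 :
    IsUnit Tangles.bicolouredGF ∧
      Tangles.tangleGF =
        1 - MvPowerSeries.X 0 - MvPowerSeries.X 1 - Tangles.bicolouredGF⁻¹ := by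
  have h := Tangles.mul_bicolouredGF
  have hB := IsUnit.of_mul_eq_one_right _ h
  refine ⟨hB, ?_⟩
  have hc : MvPowerSeries.constantCoeff Tangles.bicolouredGF ≠ 0 :=
    (hB.map MvPowerSeries.constantCoeff).ne_zero
  rw [← (MvPowerSeries.eq_inv_iff_mul_eq_one hc).2 h]
  ring
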